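/- Let $\zeta_1(z)=\dfrac{z}{z+1}\,e^{-z}$, a transcendental meromorphic function on $\mathbb{C}$ whose only pole is $-1$. Let $T_p$ be the set of real points in the backward orbit of this pole, i.e. the set of $x\in\mathbb{R}$ such that $\zeta_1^n(x)=-1$ for some $n\ge 0$. Let the Fatou set $F(\zeta_1)$ be the set of points of the Riemann sphere $\hat{\mathbb{C}}=\mathbb{C}\cup\{\infty\}$ that have an open neighbourhood on which all iterates $\zeta_1^n$ $(n\ge 0)$ are defined and meromorphic and form a normal family (with respect to the chordal metric). Then $F(\zeta_1)$ contains the sets $(-\infty,-1)$, $(-1,0)\setminus T_p$ and $(0,\infty)$ of real numbers. -/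

import Mathlib

open scoped OnePoint

/-- The meromorphic function `ζ_lam(z) = lam * (z / (z + 1)) * e^{-z}` on `ℂ`, with values in the
Riemann sphere `OnePoint ℂ`; it takes the value `∞` at its only pole `-1`. -/
noncomputable def zetaFun (lam : ℝ) (z : ℂ) : OnePoint ℂ :=
  open Classical in
  if z = -1 then ∞ else (((lam : ℂ) * (z / (z + 1)) * Complex.exp (-z) : ℂ) : OnePoint ℂ)

/-- The map `f : ℂ → Ĉ` prolonged to `Ĉ` by the bookkeeping convention `∞ ↦ ∞`, so that it can be
iterated. A transcendental meromorphic `f` has no value at `∞`: which iterates are defined at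
which points is recorded by `IterateDefinedAt`. -/
def sphereExt (f : ℂ → OnePoint ℂ) (z : OnePoint ℂ) : OnePoint ℂ :=
  z.elim ∞ f

/-- The `n`-th iterate of `f`; meaningful at the points where `IterateDefinedAt f n` holds. -/
def sphereIterate (f : ℂ → OnePoint ℂ) (n : ℕ) : OnePoint ℂ → OnePoint ℂ :=
  (sphereExt f)^[n]

/-- The `n`-th iterate of `f : ℂ → Ĉ` is defined at `z`: none of the points
`z, f z, …, f^{n-1} z`, to which `f` has to be applied, is `∞`. -/
def IterateDefinedAt (f : ℂ → OnePoint ℂ) (n : ℕ) (z : OnePoint ℂ) : Prop :=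
  ∀ k < n, sphereIterate f k z ≠ ∞

/-- The chordal distance on the Riemann sphere. -/
noncomputable def chordalDist (z w : OnePoint ℂ) : ℝ :=
  z.elim
    (w.elim 0 fun b => 2 / √(1 + ‖b‖ ^ 2))
    (fun a => w.elim (2 / √(1 + ‖a‖ ^ 2))
      fun b => 2 * ‖a - b‖ / (√(1 + ‖a‖ ^ 2) * √(1 + ‖b‖ ^ 2)))

/-- The family of maps `F i : Ĉ → Ĉ` is normal on the set `U`: every sequence of its members has a
subsequence that converges, uniformly on the compact subsets of `U` in the chordal distance. -/
def IsNormalFamilyOn {ι : Type*} (F : ι → OnePoint ℂ → OnePoint ℂ) (U : Set (OnePoint ℂ)) : Prop :=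
  ∀ i : ℕ → ι, ∃ φ : ℕ → ℕ, StrictMono φ ∧ ∃ g : OnePoint ℂ → OnePoint ℂ,
    ∀ K ⊆ U, IsCompact K → ∀ ε > 0, ∀ᶠ n in Filter.atTop,
      ∀ z ∈ K, chordalDist (F (i (φ n)) z) (g z) < ε

/-- The Fatou set of a transcendental meromorphic function `f : ℂ → Ĉ`: the points of `Ĉ` with an
open neighbourhood on which all iterates of `f` are defined and form a normal family.
(Where they are all defined, the iterates are compositions of meromorphic maps none of which is
applied at `∞`, so they are meromorphic there.) -/
def fatouSet (f : ℂ → OnePoint ℂ) : Set (OnePoint ℂ) :=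
  {z | ∃ U : Set (OnePoint ℂ), IsOpen U ∧ z ∈ U ∧
    (∀ n, ∀ w ∈ U, IterateDefinedAt f n w) ∧ IsNormalFamilyOn (sphereIterate f) U}

/-- `T_p`: the real points of the backward orbit of the pole `-1` of `ζ_lam`, that is, the real `x`
with `ζ_lam^n(x) = -1` for some `n ≥ 0`. -/
def poleBackwardOrbit (lam : ℝ) : Set ℝ :=
  {x | ∃ n : ℕ, IterateDefinedAt (zetaFun lam) n ((x : ℂ) : OnePoint ℂ) ∧
    sphereIterate (zetaFun lam) n ((x : ℂ) : OnePoint ℂ) = ((-1 : ℂ) : OnePoint ℂ)}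

/-! The origin is a parabolic fixed point of multiplier 1. In the coordinate `u = 1/z` the map is `u
↦ (u + 1) e^{1/u} = u + 2 + O(1/u)`, so `Re u ≥ 3` is an attracting petal: each step raises `Re u`
by at least 1 (`re_inv_zetaFin_ge`). Being attracted to 0 passes to preimages away from the pole
(`LocallyAttracted.of_zetaFin`), so each real orbit only has to reach the petal. -/

/-- The finite-valued expression of `ζ₁`; at the pole `-1` it takes the value `0`. -/
noncomputable def zetaFin (z : ℂ) : ℂ := z / (z + 1) * Complex.exp (-z)

/-- Near `z` the iterates of `zetaFin` avoid the pole and converge uniformly to `0`. -/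
def LocallyAttracted (z : ℂ) : Prop :=
  ∃ U : Set ℂ, IsOpen U ∧ z ∈ U ∧ (∀ w ∈ U, ∀ n, zetaFin^[n] w ≠ -1) ∧
    ∀ ε > 0, ∀ᶠ n in Filter.atTop, ∀ w ∈ U, ‖zetaFin^[n] w‖ < ε

theorem zetaFun_one_coe {z : ℂ} (hz : z ≠ -1) : zetaFun 1 z = (zetaFin z : OnePoint ℂ) := by
  simp [zetaFun, zetaFin, hz]

theorem sphereIterate_zero (f : ℂ → OnePoint ℂ) (z : OnePoint ℂ) : sphereIterate f 0 z = z := rfl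

theorem sphereIterate_succ_coe {z : ℂ} (hz : z ≠ -1) (n : ℕ) :
    sphereIterate (zetaFun 1) (n + 1) z = sphereIterate (zetaFun 1) n (zetaFin z) := by
  have h : sphereExt (zetaFun 1) z = (zetaFin z : OnePoint ℂ) := zetaFun_one_coe hz
  rw [sphereIterate, Function.iterate_succ_apply, h, sphereIterate]

theorem sphereIterate_coe (n : ℕ) {z : ℂ} (hz : ∀ k, zetaFin^[k] z ≠ -1) :
    sphereIterate (zetaFun 1) n z = (zetaFin^[n] z : ℂ) := by
  induction n generalizing z with
  | zero => rfl
  | succ n ih =>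
    rw [sphereIterate_succ_coe (z := z) (hz 0), ih fun k => by simpa using hz (k + 1),
      Function.iterate_succ_apply]

theorem chordalDist_coe_zero_le (a : ℂ) : chordalDist a (0 : ℂ) ≤ 2 * ‖a‖ := by
  have h : chordalDist a (0 : ℂ)
      = 2 * ‖a - 0‖ / (√(1 + ‖a‖ ^ 2) * √(1 + ‖(0 : ℂ)‖ ^ 2)) := rfl
  rw [h]
  simp only [sub_zero, norm_zero, ne_eq, OfNat.ofNat_ne_zero, not_false_eq_true, zero_pow,
    add_zero, Real.sqrt_one, mul_one]
  exact div_le_self (by positivity) (Real.one_le_sqrt.2 (by nlinarith [sq_nonneg ‖a‖]))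

theorem chordalDist_self (z : OnePoint ℂ) : chordalDist z z = 0 := by
  induction z using OnePoint.rec with
  | infty => rfl
  | coe a =>
    have h : chordalDist a a = 2 * ‖a - a‖ / (√(1 + ‖a‖ ^ 2) * √(1 + ‖a‖ ^ 2)) := rfl
    simp [h]

/-- A sequence of indices either repeats a value infinitely often, giving a constant subsequence, or
tends to infinity. -/
theorem isNormalFamilyOn_of_uniform_limit {F : ℕ → OnePoint ℂ → OnePoint ℂ}
    {U : Set (OnePoint ℂ)} {g : OnePoint ℂ → OnePoint ℂ}
    (h : ∀ ε > 0, ∀ᶠ n in Filter.atTop, ∀ z ∈ U, chordalDist (F n z) (g z) < ε) :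
    IsNormalFamilyOn F U := by
  intro i
  by_cases hi : ∃ v, ∃ᶠ n in Filter.atTop, i n = v
  · obtain ⟨v, hv⟩ := hi
    obtain ⟨φ, hφ, hφv⟩ := Filter.extraction_of_frequently_atTop hv
    refine ⟨φ, hφ, F v, fun K _ _ ε hε => Filter.Eventually.of_forall fun n z _ => ?_⟩
    rw [hφv n, chordalDist_self]
    exact hε
  · have hlim : Filter.Tendsto i Filter.atTop Filter.atTop := by
      refine Filter.tendsto_atTop.2 fun b => ?_
      have hne : ∀ᶠ n in Filter.atTop, ∀ v ∈ Finset.range b, i n ≠ v :=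
        (Filter.eventually_all_finset _).2 fun v _ => by
          simpa [Filter.not_frequently] using not_exists.1 hi v
      filter_upwards [hne] with n hn
      by_contra hlt
      exact hn (i n) (Finset.mem_range.2 (not_le.1 hlt)) rfl
    refine ⟨id, strictMono_id, g, fun K hK _ ε hε => ?_⟩
    filter_upwards [hlim.eventually (h ε hε)] with n hn z hz using hn z (hK hz)

theorem LocallyAttracted.mem_fatouSet {z : ℂ} (hz : LocallyAttracted z) :
    (z : OnePoint ℂ) ∈ fatouSet (zetaFun 1) := by
  obtain ⟨U, hU, hzU, hpole, hlim⟩ := hz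
  refine ⟨(↑) '' U, OnePoint.isOpenEmbedding_coe.isOpenMap U hU, ⟨z, hzU, rfl⟩, ?_, ?_⟩
  · rintro n _ ⟨w, hw, rfl⟩ k -
    rw [sphereIterate_coe k (hpole w hw)]
    exact OnePoint.coe_ne_infty _
  · refine isNormalFamilyOn_of_uniform_limit (g := fun _ => ((0 : ℂ) : OnePoint ℂ)) ?_
    intro ε hε
    filter_upwards [hlim (ε / 2) (half_pos hε)] with n hn
    rintro _ ⟨w, hw, rfl⟩
    rw [sphereIterate_coe n (hpole w hw)]
    linarith [chordalDist_coe_zero_le (zetaFin^[n] w), hn w hw]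

theorem continuousAt_zetaFin {z : ℂ} (hz : z ≠ -1) : ContinuousAt zetaFin z := by
  have h : z + 1 ≠ 0 := fun h => hz (eq_neg_of_add_eq_zero_left h)
  unfold zetaFin
  fun_prop (disch := assumption)

theorem LocallyAttracted.of_zetaFin {z : ℂ} (hz : z ≠ -1) (h : LocallyAttracted (zetaFin z)) :
    LocallyAttracted z := by
  obtain ⟨U, hU, hzU, hpole, hlim⟩ := h
  have hnhds : {w | w ≠ -1 ∧ zetaFin w ∈ U} ∈ nhds z :=
    (isOpen_ne.eventually_mem hz).and ((continuousAt_zetaFin hz).eventually_mem (hU.mem_nhds hzU))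
  obtain ⟨V, hVsub, hV, hzV⟩ := mem_nhds_iff.1 hnhds
  refine ⟨V, hV, hzV, fun w hw n => ?_, fun ε hε => ?_⟩
  · cases n with
    | zero => exact (hVsub hw).1
    | succ n => exact hpole _ (hVsub hw).2 n
  · refine Filter.eventually_atTop.2 ?_
    obtain ⟨N, hN⟩ := Filter.eventually_atTop.1 (hlim ε hε)
    refine ⟨N + 1, fun n hn w hw => ?_⟩
    obtain ⟨m, rfl⟩ : ∃ m, n = m + 1 := ⟨n - 1, by omega⟩
    exact hN m (by omega) _ (hVsub hw).2

theorem inv_zetaFin (z : ℂ) (hz : z ≠ 0) : (zetaFin z)⁻¹ = (z⁻¹ + 1) * Complex.exp z := by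
  rw [zetaFin, mul_inv, inv_div, ← Complex.exp_neg, neg_neg]
  field_simp
  ring

theorem norm_le_inv_of_le_re_inv {z : ℂ} {r : ℝ} (hr : 0 < r) (hz : r ≤ z⁻¹.re) :
    ‖z‖ ≤ r⁻¹ := by
  rw [← inv_inv z, norm_inv]
  exact inv_anti₀ hr (hz.trans (Complex.re_le_norm _))

theorem re_inv_zetaFin_ge {z : ℂ} (hz : 3 ≤ z⁻¹.re) : z⁻¹.re + 1 ≤ (zetaFin z)⁻¹.re := by
  have hz0 : z ≠ 0 := by rintro rfl; norm_num at hz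
  have hn : ‖z‖ ≤ 3⁻¹ := norm_le_inv_of_le_re_inv (by norm_num) hz
  have hpos : 0 < ‖z‖ := norm_pos_iff.2 hz0
  -- Second-order remainder of `exp`: `|E| ≤ |z|²` and `|z| ≤ 1/3` keep the error below the main
  -- shift 2 by at least 1.
  set E := Complex.exp z - 1 - z with hE
  have hEle : ‖E‖ ≤ ‖z‖ ^ 2 := Complex.norm_exp_sub_one_sub_id_le (by linarith)
  have hexp : (zetaFin z)⁻¹ = z⁻¹ + 2 + (z + (z⁻¹ + 1) * E) := by
    rw [inv_zetaFin z hz0, hE]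
    field_simp
    ring
  have hrem : ‖z + (z⁻¹ + 1) * E‖ ≤ 1 := by
    have h1 : ‖z⁻¹ + 1‖ ≤ ‖z‖⁻¹ + 1 := by
      simpa using norm_add_le z⁻¹ (1 : ℂ)
    calc ‖z + (z⁻¹ + 1) * E‖ ≤ ‖z‖ + ‖z⁻¹ + 1‖ * ‖E‖ := by
          simpa using norm_add_le z ((z⁻¹ + 1) * E)
      _ ≤ ‖z‖ + (‖z‖⁻¹ + 1) * ‖z‖ ^ 2 := by gcongr
      _ = 2 * ‖z‖ + ‖z‖ ^ 2 := by field_simp; ring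
      _ ≤ 1 := by nlinarith
  have hre := (abs_le.1 ((Complex.abs_re_le_norm _).trans hrem)).1
  rw [hexp, Complex.add_re, Complex.add_re z⁻¹ 2, Complex.re_ofNat]
  linarith

theorem re_inv_iterate_zetaFin_ge {z : ℂ} (hz : 3 ≤ z⁻¹.re) (n : ℕ) :
    3 + (n : ℝ) ≤ (zetaFin^[n] z)⁻¹.re := by
  induction n with
  | zero => simpa using hz
  | succ n ih =>
    rw [Function.iterate_succ_apply']
    have h := re_inv_zetaFin_ge (z := zetaFin^[n] z) (by linarith [Nat.cast_nonneg (α := ℝ) n])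
    push_cast
    linarith

theorem locallyAttracted_of_lt_re_inv {z : ℂ} (hz : 3 < z⁻¹.re) : LocallyAttracted z := by
  have hz0 : z ≠ 0 := by rintro rfl; norm_num at hz
  have hcont : ContinuousAt (fun w : ℂ => w⁻¹.re) z :=
    Complex.continuous_re.continuousAt.comp (continuousAt_inv₀ hz0)
  obtain ⟨U, hUsub, hU, hzU⟩ := mem_nhds_iff.1 (hcont.eventually_const_lt hz)
  refine ⟨U, hU, hzU, fun w hw n hn => ?_, fun ε hε => ?_⟩
  -- The pole has `u = -1`, outside the petal.
  · have h := re_inv_iterate_zetaFin_ge (le_of_lt (hUsub hw)) n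
    rw [hn] at h
    norm_num at h
    linarith [Nat.cast_nonneg (α := ℝ) n]
  · filter_upwards [Filter.eventually_gt_atTop ⌈ε⁻¹⌉₊] with n hn w hw
    have hn' : ε⁻¹ < n := Nat.lt_of_ceil_lt hn
    have h := re_inv_iterate_zetaFin_ge (le_of_lt (hUsub hw)) n
    refine (norm_le_inv_of_le_re_inv (by positivity) h).trans_lt ?_
    exact inv_lt_of_inv_lt₀ hε (by linarith)

/-- The restriction of `ζ₁` to the real line. -/
noncomputable def zetaReal (x : ℝ) : ℝ := x / (x + 1) * Real.exp (-x)

theorem zetaFin_ofReal (x : ℝ) : zetaFin x = zetaReal x := by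
  simp [zetaFin, zetaReal]

theorem inv_zetaReal {x : ℝ} (hx : x ≠ 0) : (zetaReal x)⁻¹ = (x⁻¹ + 1) * Real.exp x := by
  rw [zetaReal, mul_inv, inv_div, ← Real.exp_neg, neg_neg]
  field_simp
  ring

theorem ofReal_ne_neg_one {x : ℝ} (hx : x ≠ -1) : (x : ℂ) ≠ -1 := by
  exact_mod_cast hx

theorem LocallyAttracted.of_zetaReal {x : ℝ} (hx : x ≠ -1)
    (h : LocallyAttracted (zetaReal x : ℂ)) : LocallyAttracted (x : ℂ) :=
  LocallyAttracted.of_zetaFin (ofReal_ne_neg_one hx) (by rwa [zetaFin_ofReal])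

theorem locallyAttracted_of_pos {x : ℝ} (hx : 0 < x) : LocallyAttracted (x : ℂ) := by
  -- For `x > 0`, `(u + 1) e^x ≥ u + 1`, so `n` steps suffice to get `u > 3`.
  obtain ⟨n, hn⟩ := exists_nat_gt (3 - x⁻¹)
  induction n generalizing x with
  | zero =>
    refine locallyAttracted_of_lt_re_inv ?_
    rw [← Complex.ofReal_inv, Complex.ofReal_re]
    simpa using hn
  | succ n ih =>
    have hinv := inv_zetaReal hx.ne'
    have hpos : 0 < zetaReal x := by unfold zetaReal; positivity
    have hx' : 0 < x⁻¹ := inv_pos.2 hx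
    refine LocallyAttracted.of_zetaReal (by linarith) (ih hpos ?_)
    rw [hinv]
    push_cast at hn
    nlinarith [Real.one_le_exp hx.le]

theorem locallyAttracted_of_lt_neg_one {x : ℝ} (hx : x < -1) : LocallyAttracted (x : ℂ) :=
  LocallyAttracted.of_zetaReal hx.ne <| locallyAttracted_of_pos <|
    mul_pos (div_pos_of_neg_of_neg (by linarith) (by linarith)) (Real.exp_pos _)

theorem neg_one_mem_poleBackwardOrbit : (-1 : ℝ) ∈ poleBackwardOrbit 1 :=
  ⟨0, fun k hk => absurd hk (Nat.not_lt_zero k), by simp [sphereIterate_zero]⟩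

theorem mem_poleBackwardOrbit_of_zetaReal {x : ℝ} (hx : x ≠ -1)
    (h : zetaReal x ∈ poleBackwardOrbit 1) : x ∈ poleBackwardOrbit 1 := by
  obtain ⟨n, hdef, hn⟩ := h
  have hstep (k : ℕ) : sphereIterate (zetaFun 1) (k + 1) (x : ℂ)
      = sphereIterate (zetaFun 1) k (zetaReal x : ℂ) := by
    rw [sphereIterate_succ_coe (ofReal_ne_neg_one hx), zetaFin_ofReal]
  refine ⟨n + 1, fun k hk => ?_, by rw [hstep, hn]⟩
  cases k with
  | zero => exact OnePoint.coe_ne_infty _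
  | succ k =>
    rw [hstep]
    exact hdef k (by omega)

/-- On `(-1, 0)`, `u + 1 < 0` and `e^x ≤ 1`, so again `u` grows by at least 1 per step. The orbit
stays negative and must leave `(-1, 0)`; as it misses the pole, it lands below `-1`, whence it jumps
to the positive axis. -/
theorem locallyAttracted_of_neg {x : ℝ} (hx : x < 0) (hp : x ∉ poleBackwardOrbit 1) :
    LocallyAttracted (x : ℂ) := by
  obtain ⟨n, hn⟩ := exists_nat_gt (-1 - x⁻¹)
  induction n generalizing x with
  | zero =>
    refine locallyAttracted_of_lt_neg_one ?_
    have h : -x⁻¹ < 1 := by simpa [sub_lt_iff_lt_add, neg_lt] using hn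
    rw [← inv_neg, inv_lt_one₀ (by linarith)] at h
    linarith
  | succ n ih =>
    have hne : x ≠ -1 := fun h => hp (h ▸ neg_one_mem_poleBackwardOrbit)
    rcases lt_or_gt_of_ne hne with hlt | hgt
    · exact locallyAttracted_of_lt_neg_one hlt
    have hneg : zetaReal x < 0 :=
      mul_neg_of_neg_of_pos (div_neg_of_neg_of_pos hx (by linarith)) (Real.exp_pos _)
    have hx' : x⁻¹ + 1 < 0 := by
      have h : 1 < (-x)⁻¹ := (one_lt_inv₀ (by linarith)).2 (by linarith)
      rw [inv_neg] at h
      linarith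
    refine LocallyAttracted.of_zetaReal hne
      (ih hneg (fun h => hp (mem_poleBackwardOrbit_of_zetaReal hne h)) ?_)
    rw [inv_zetaReal hx.ne]
    push_cast at hn
    nlinarith [Real.exp_le_one_iff.2 hx.le]

theorem mainTheorem6 :
    (∀ x ∈ Set.Iio (-1 : ℝ), ((x : ℂ) : OnePoint ℂ) ∈ fatouSet (zetaFun 1)) ∧
    (∀ x ∈ Set.Ioo (-1 : ℝ) 0 \ poleBackwardOrbit 1,
      ((x : ℂ) : OnePoint ℂ) ∈ fatouSet (zetaFun 1)) ∧
    (∀ x ∈ Set.Ioi (0 : ℝ), ((x : ℂ) : OnePoint ℂ) ∈ fatouSet (zetaFun 1)) :=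
  ⟨fun _ hx => (locallyAttracted_of_lt_neg_one hx).mem_fatouSet,
    fun _ hx => (locallyAttracted_of_neg hx.1.2 hx.2).mem_fatouSet,
    fun _ hx => (locallyAttracted_of_pos hx).mem_fatouSet⟩
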